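/- Let $m\ge 0$, let $\mathsf N_0\in\mathbb R$, and let $\lambda_i>0$, $\mathsf Z_i>0$ for $i=1,\dots,m$. Put $\mathcal F=\{(\mathsf N_1,\dots,\mathsf N_m)\in\mathbb R^m:\ \sum_{i=1}^m\mathsf N_i\le\mathsf N_0,\ \mathsf N_i\ge 0 \text{ for all } i\}$. For every $(\mathsf N_1,\dots,\mathsf N_m)\in\mathcal F$ and every $i$ let $Y_i=X_i+Z_i+N_i$, where $X_i\sim\mathrm{Exp}(\lambda_i)$, $Z_i\sim\mathcal N(0,\mathsf Z_i)$ and $N_i\sim\mathcal N(0,\mathsf N_i)$ are independent (only $N_i$ depends on the allocation). Let $\mathsf P_i=\mathbb E[X_i^2]$, $\rho_i=\mathsf P_i/(\mathsf N_i+\mathsf Z_i)$, $S_i=X_i/\sqrt{\mathsf P_i}$, $W_i=(Z_i+N_i)/\sqrt{\mathsf N_i+\mathsf Z_i}$, $\widetilde Y_i=\sqrt{\rho_i}\,S_i+W_i$, and $Q(x)=\int_x^\infty\frac1{\sqrt{2\pi}}e^{-t^2/2}\,dt$. (1) For every allocation in $\mathcal F$ and every $i$: $\rho_i=\frac{2}{\lambda_i^2(\mathsf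 N_i+\mathsf Z_i)}$, $S_i\sim\mathrm{Exp}(\sqrt2)$, $W_i\sim\mathcal N(0,1)$, $\widetilde Y_i=Y_i/\sqrt{\mathsf N_i+\mathsf Z_i}$, and $\widetilde Y_i$ has the exponentially modified Gaussian density $$f(\widetilde y)=\sqrt{\tfrac{2}{\rho_i}}\,\exp\!\Big(\tfrac1{\rho_i}-\widetilde y\sqrt{\tfrac2{\rho_i}}\Big)\,Q\Big(-\widetilde y+\sqrt{\tfrac2{\rho_i}}\Big).$$ This density is positive and twice continuously differentiable, $-1\le \frac{d^2}{d\widetilde y^2}\log f(\widetilde y)\le 0$ for all $\widetilde y\in\mathbb R$, and consequently condition (C3) holds: the expectation $\mathbb E\big[\big(\tfrac{d^2}{d\widetilde Y_i^2}\log f(\widetilde Y_i)\big)^2\big]$ exists and is at most $1$. (2) The total mutual information minimization problem $$\text{minimize }\ \sum_{i=1}^m I(X_i;Y_i)\quad\text{subject to }\ \sum_{i=1}^m\mathsf N_i\le\mathsf N_0,\ \ \mathsf N_i\ge0,$$ is convex: each $I(X_i;Y_i)=D_{\mathrm{KL}}(P_{X_iY_i}\,\|\,P_{X_i}\otimes P_{Y_i})$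 is finite on $\mathcal F$, $\mathcal F$ is a convex set, and the objective is a convex function of $(\mathsf N_1,\dots,\mathsf N_m)$ on $\mathcal F$. -/

import Mathlib

open MeasureTheory ProbabilityTheory
open scoped ENNReal NNReal

noncomputable section

/-- Mutual information `I(X; Y)` (in nats): the Kullback-Leibler divergence of the joint law
from the product of the marginal laws. -/
def mutualInfo {Ω α β : Type*} [MeasurableSpace Ω] [MeasurableSpace α] [MeasurableSpace β]
    (P : Measure Ω) (X : Ω → α) (Y : Ω → β) : ℝ≥0∞ :=
  InformationTheory.klDiv (P.map (fun ω => (X ω, Y ω))) ((P.map X).prod (P.map Y))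

/-- The power `E[X²]` of a random variable. -/
def power {Ω : Type*} [MeasurableSpace Ω] (P : Measure Ω) (X : Ω → ℝ) : ℝ :=
  ∫ ω, X ω ^ 2 ∂P

/-- The signal-to-noise ratio `E[X²] / (n + z)`, where `z` is the variance of the physical noise
and `n` is the variance of the artificial noise. -/
def snr {Ω : Type*} [MeasurableSpace Ω] (P : Measure Ω) (X : Ω → ℝ) (z n : ℝ) : ℝ :=
  power P X / (n + z)

/-- The unit-power input `S = X / √E[X²]`. -/
def normalizedInput {Ω : Type*} [MeasurableSpace Ω] (P : Measure Ω) (X : Ω → ℝ) : Ω → ℝ :=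
  fun ω => X ω / √(power P X)

/-- The unit-power noise `W = (Z + N) / √(n + z)`. -/
def normalizedNoise {Ω : Type*} (Z N : Ω → ℝ) (z n : ℝ) : Ω → ℝ :=
  fun ω => (Z ω + N ω) / √(n + z)

/-- The normalized output `Ỹ = √ρ S + W`. -/
def normalizedOutput {Ω : Type*} [MeasurableSpace Ω] (P : Measure Ω) (X Z N : Ω → ℝ)
    (z n : ℝ) : Ω → ℝ :=
  fun ω => √(snr P X z n) * normalizedInput P X ω + normalizedNoise Z N z n ω

/-- The Gaussian tail function `Q(x) = ∫_x^∞ (2π)^(-1/2) exp(-t²/2) dt`. -/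
def gaussianQ (x : ℝ) : ℝ :=
  ∫ t in Set.Ioi x, 1 / √(2 * Real.pi) * Real.exp (-t ^ 2 / 2)

/-- The exponentially modified Gaussian density of `√ρ S + W`, for independent `S ∼ Exp(√2)`
and `W ∼ N(0, 1)`. -/
def emgDensity (ρ y : ℝ) : ℝ :=
  √(2 / ρ) * Real.exp (1 / ρ - y * √(2 / ρ)) * gaussianQ (-y + √(2 / ρ))

/-- The second derivative `d²/dy² log f(y)`. -/
def logDensitySecondDeriv (f : ℝ → ℝ) (y : ℝ) : ℝ :=
  iteratedDeriv 2 (fun u => Real.log (f u)) y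

/-- Condition (C3), `E[(d²/dỸ² log f(Ỹ))²] ≤ 1`, for a random variable `Y` with smooth positive
density `f`; the expectation is required to exist. -/
structure ConditionC3 {Ω : Type*} [MeasurableSpace Ω] (P : Measure Ω) (Y : Ω → ℝ)
    (f : ℝ → ℝ) : Prop where
  hasLaw : HasLaw Y (volume.withDensity (fun y => ENNReal.ofReal (f y))) P
  pos : ∀ y, 0 < f y
  contDiff : ContDiff ℝ 2 f
  integrable : Integrable (fun ω => logDensitySecondDeriv f (Y ω) ^ 2) P
  le_one : ∫ ω, logDensitySecondDeriv f (Y ω) ^ 2 ∂P ≤ 1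

/-- The artificial-noise allocations allowed by the total power budget `N₀`. -/
def feasibleSet (m : ℕ) (N₀ : ℝ) : Set (Fin m → ℝ) :=
  {n | ∑ i, n i ≤ N₀ ∧ ∀ i, 0 ≤ n i}

end

open Set Filter Topology

/-! Dividing the channel by `√(n + z)` gives `Y = T + W` with `T ∼ Exp(s)`, `s = l √(n + z)`, and
`W` standard Gaussian; mutual information is unchanged by this scaling. The density of `Y` is `f y =
s exp(s²/2 - s y) Q(s - y)`, which is the stated one because `ρ = 2 / s²`.

Let `h = φ/Q` be the Gaussian hazard rate, `φ` the standard Gaussian density. Then `(log f)''(y) =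
-k(s - y)` with `k x = h x (h x - x) = h' x`. Here `k ≥ 0` because the mean of a Gaussian
conditioned to exceed `x` is at least `x`, and `k ≤ 1` because its variance `1 - k x` is
nonnegative. This gives the bounds on the second derivative and (C3).

For convexity, `I = E log (φ(W) / f(Y))` equals, up to a constant, `noiseInfo v = -log v / 2 - v / 2
- E log Q(√v + W)` at `v = s² = l² (n + z)`. This needs `integral_log_gaussianQ_conv`, which trades
an expectation over `s - Y` for one over `s + W`. Since `v` is affine in `n`, convexity of
`noiseInfo` is enough. With `g s = E h(s + W)`, its second derivative is `(2 - (s g - s² g')) / (4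
v²)`, and an integration by parts gives `s g - s² g' = 2 E[k(s - Y)²] = 2 E[((log f)''(Y))²]`. Thus
(C3) is precisely what makes the problem convex (`mul_expectedHazard_sub_le`, `convexOn_noiseInfo`).
-/

/-! ### Gaussian density, tail and truncated moments. -/

/-- The standard Gaussian density. -/
noncomputable def stdGaussianDensity (t : ℝ) : ℝ := 1 / √(2 * Real.pi) * Real.exp (-t ^ 2 / 2)

lemma stdGaussianDensity_eq_gaussianPDFReal (t : ℝ) :
    stdGaussianDensity t = gaussianPDFReal 0 1 t := by
  simp [stdGaussianDensity, gaussianPDFReal]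

lemma stdGaussianDensity_pos (t : ℝ) : 0 < stdGaussianDensity t := by
  unfold stdGaussianDensity; positivity

lemma hasDerivAt_stdGaussianDensity (t : ℝ) :
    HasDerivAt stdGaussianDensity (-t * stdGaussianDensity t) t := by
  unfold stdGaussianDensity
  have h : HasDerivAt (fun t : ℝ => -t ^ 2 / 2) (-t) t := by
    exact ((hasDerivAt_pow 2 t).fun_neg.div_const 2).congr_deriv (by simp; ring)
  exact (h.exp.const_mul (1 / √(2 * Real.pi))).congr_deriv (by ring)

lemma contDiff_stdGaussianDensity {n : WithTop ℕ∞} : ContDiff ℝ n stdGaussianDensity := by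
  unfold stdGaussianDensity; fun_prop

lemma continuous_stdGaussianDensity : Continuous stdGaussianDensity :=
  (contDiff_stdGaussianDensity (n := 0)).continuous

lemma integrable_stdGaussianDensity : Integrable stdGaussianDensity := by
  rw [funext stdGaussianDensity_eq_gaussianPDFReal]
  exact integrable_gaussianPDFReal 0 1

lemma integral_stdGaussian_eq (F : ℝ → ℝ) :
    ∫ w, F w ∂gaussianReal 0 1 = ∫ w, stdGaussianDensity w * F w := by
  rw [integral_gaussianReal_eq_integral_smul (by simp)]
  simp [stdGaussianDensity_eq_gaussianPDFReal]

lemma integrable_stdGaussian_iff (F : ℝ → ℝ) :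
    Integrable F (gaussianReal 0 1) ↔ Integrable (fun w => stdGaussianDensity w * F w) := by
  rw [gaussianReal_of_var_ne_zero _ (by simp), integrable_withDensity_iff_integrable_smul'
    (measurable_gaussianPDF _ _) (by simp [gaussianPDF_lt_top])]
  simp [stdGaussianDensity_eq_gaussianPDFReal]

/-- Continuous functions of at most quadratic growth are integrable when the square is. -/
lemma integrable_of_quadratic_bound {μ : Measure ℝ} [IsFiniteMeasure μ]
    (h2 : Integrable (fun x : ℝ => x ^ 2) μ) {F : ℝ → ℝ} (hF : Continuous F) {C D : ℝ}
    (hb : ∀ x, |F x| ≤ C + D * x ^ 2) : Integrable F μ :=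
  Integrable.mono' ((integrable_const C).add (h2.const_mul D)) hF.aestronglyMeasurable
    (Eventually.of_forall fun x => by simpa using hb x)

lemma integrable_sq_stdGaussian : Integrable (fun x : ℝ => x ^ 2) (gaussianReal 0 1) := by
  simpa using (memLp_id_gaussianReal (μ := 0) (v := 1) 2).integrable_sq

lemma hasDerivAt_gaussianQ (x : ℝ) : HasDerivAt gaussianQ (-stdGaussianDensity x) x := by
  have hI := integrable_stdGaussianDensity
  have h : gaussianQ = fun y => gaussianQ 0 - ∫ t in (0 : ℝ)..y, stdGaussianDensity t := by
    ext y
    have := intervalIntegral.integral_interval_add_Ioi (a := 0) (b := y)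
      (f := stdGaussianDensity) hI.integrableOn hI.integrableOn
    simp only [gaussianQ]
    simp only [stdGaussianDensity] at this ⊢
    linarith
  rw [h]
  exact (intervalIntegral.integral_hasDerivAt_right hI.intervalIntegrable
    (continuous_stdGaussianDensity.stronglyMeasurableAtFilter _ _)
    continuous_stdGaussianDensity.continuousAt).const_sub _

lemma gaussianQ_pos (x : ℝ) : 0 < gaussianQ x := by
  have : gaussianQ x = ∫ t in Ioi x, stdGaussianDensity t := rfl
  rw [this, setIntegral_pos_iff_support_of_nonneg_ae
    (Eventually.of_forall fun t => (stdGaussianDensity_pos t).le)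
    integrable_stdGaussianDensity.integrableOn]
  have : Function.support stdGaussianDensity = univ := by
    ext t; simp [(stdGaussianDensity_pos t).ne']
  simp [this]

lemma contDiff_gaussianQ : ContDiff ℝ 2 gaussianQ := by
  have : deriv gaussianQ = fun x => -stdGaussianDensity x :=
    funext fun x => (hasDerivAt_gaussianQ x).deriv
  rw [show (2 : WithTop ℕ∞) = 1 + 1 from by norm_num, contDiff_succ_iff_deriv]
  exact ⟨fun x => (hasDerivAt_gaussianQ x).differentiableAt, by simp,
    this ▸ contDiff_stdGaussianDensity.neg⟩

lemma continuous_gaussianQ : Continuous gaussianQ := contDiff_gaussianQ.continuous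

lemma tendsto_mul_stdGaussianDensity_atTop (a b : ℝ) :
    Tendsto (fun t => (a * t + b) * stdGaussianDensity t) atTop (𝓝 0) := by
  have h0 := (rexp_neg_quadratic_isLittleO_rpow_atTop (a := -(1 / 2)) (by norm_num) 0 (-2))
  have hlim (k : ℕ) (hk : k < 2) : Tendsto (fun t : ℝ => t ^ k * Real.exp (-t ^ 2 / 2))
      -- The factor is `o(x⁻²)`, which beats the powers `k = 0, 1` needed for an affine prefactor.
      atTop (𝓝 0) := by
    have h1 : Tendsto (fun x : ℝ => x ^ k * x ^ (-2 : ℝ)) atTop (𝓝 0) := by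
      have := tendsto_rpow_neg_atTop (y := 2 - k) (by
        have : (k : ℝ) < 2 := by exact_mod_cast hk
        linarith)
      refine this.congr' ?_
      filter_upwards [eventually_gt_atTop 0] with x hx
      rw [← Real.rpow_natCast, ← Real.rpow_add hx]; ring_nf
    refine ((Asymptotics.isBigO_refl (fun x : ℝ => x ^ k) atTop).mul h0.isBigO).trans_tendsto h1
      |>.congr fun x => ?_
    ring_nf
  have := ((hlim 1 (by norm_num)).const_mul (a * (1 / √(2 * Real.pi)))).add
    ((hlim 0 (by norm_num)).const_mul (b * (1 / √(2 * Real.pi))))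
  simp only [mul_zero, add_zero] at this
  refine this.congr fun x => ?_
  simp only [stdGaussianDensity]; ring

lemma integrable_quadratic_mul_stdGaussianDensity (a b c : ℝ) :
    Integrable (fun t => (a * t ^ 2 + b * t + c) * stdGaussianDensity t) := by
  have h := integrable_of_quadratic_bound integrable_sq_stdGaussian
    (F := fun t => a * t ^ 2 + b * t + c) (by fun_prop) (C := |b| + |c|) (D := |a| + |b|)
    (fun t => by
      have h1 : |t| ≤ 1 + t ^ 2 := by nlinarith [sq_nonneg (|t| - 1), sq_abs t, abs_nonneg t]
      calc |a * t ^ 2 + b * t + c| ≤ |a * t ^ 2| + |b * t| + |c| := abs_add_three _ _ _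
        _ = |a| * t ^ 2 + |b| * |t| + |c| := by simp [abs_mul]
        _ ≤ _ := by nlinarith [mul_le_mul_of_nonneg_left h1 (abs_nonneg b)])
  rw [integrable_stdGaussian_iff] at h
  simpa only [mul_comm] using h

/-- The second moment of a Gaussian tail about an arbitrary point. -/
lemma integral_Ioi_sub_sq_mul_stdGaussianDensity (x c : ℝ) :
    ∫ t in Ioi x, (t - c) ^ 2 * stdGaussianDensity t =
      (1 + c ^ 2) * gaussianQ x + (x - 2 * c) * stdGaussianDensity x := by
  -- Split `(t - c)² = (1 + c²) + (t² - 2ct - 1)`: against the density, the second summand is an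
  -- exact derivative.
  have hd (t : ℝ) : HasDerivAt (fun t => -(t - 2 * c) * stdGaussianDensity t)
      ((t ^ 2 - 2 * c * t - 1) * stdGaussianDensity t) t := by
    exact (((hasDerivAt_id t).sub_const (2 * c)).fun_neg.mul
      (hasDerivAt_stdGaussianDensity t)).congr_deriv (by simp; ring)
  have hi : Integrable (fun t => (t ^ 2 - 2 * c * t - 1) * stdGaussianDensity t) := by
    refine (integrable_quadratic_mul_stdGaussianDensity 1 (-2 * c) (-1)).congr
      (Eventually.of_forall fun t => ?_)
    ring_nf
  have hl : Tendsto (fun t => -(t - 2 * c) * stdGaussianDensity t) atTop (𝓝 0) :=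
    (tendsto_mul_stdGaussianDensity_atTop (-1) (2 * c)).congr fun t => by ring
  have h1 := integral_Ioi_of_hasDerivAt_of_tendsto' (a := x) (fun t _ => hd t) hi.integrableOn hl
  have h2 : ∀ t, (t - c) ^ 2 * stdGaussianDensity t = (1 + c ^ 2) * stdGaussianDensity t +
      (t ^ 2 - 2 * c * t - 1) * stdGaussianDensity t := fun t => by ring
  simp_rw [h2]
  rw [integral_add (integrable_stdGaussianDensity.const_mul _).integrableOn hi.integrableOn,
    integral_const_mul, h1]
  simp only [gaussianQ, stdGaussianDensity]
  ring

/-! ### Hazard rate: derivative, bounds and growth. -/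

/-- The hazard rate of the standard Gaussian (the inverse Mills ratio). -/
noncomputable def gaussianHazard (x : ℝ) : ℝ := stdGaussianDensity x / gaussianQ x

lemma gaussianHazard_pos (x : ℝ) : 0 < gaussianHazard x :=
  div_pos (stdGaussianDensity_pos x) (gaussianQ_pos x)

lemma gaussianHazard_mul_gaussianQ (x : ℝ) :
    gaussianHazard x * gaussianQ x = stdGaussianDensity x :=
  div_mul_cancel₀ _ (gaussianQ_pos x).ne'

lemma continuous_gaussianHazard : Continuous gaussianHazard :=
  continuous_stdGaussianDensity.div continuous_gaussianQ fun x => (gaussianQ_pos x).ne'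

lemma hasDerivAt_gaussianHazard (x : ℝ) :
    HasDerivAt gaussianHazard (gaussianHazard x * (gaussianHazard x - x)) x := by
  refine ((hasDerivAt_stdGaussianDensity x).div (hasDerivAt_gaussianQ x)
    (gaussianQ_pos x).ne').congr_deriv ?_
  have := (gaussianQ_pos x).ne'
  unfold gaussianHazard
  field_simp
  ring

/-- The mean of the Gaussian conditioned on exceeding `x` is at least `x`. -/
lemma le_gaussianHazard (x : ℝ) : x ≤ gaussianHazard x := by
  have hd (t : ℝ) : HasDerivAt (fun t => -stdGaussianDensity t) (t * stdGaussianDensity t) t := by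
    exact (hasDerivAt_stdGaussianDensity t).fun_neg.congr_deriv (by ring)
  have hi : Integrable (fun t => t * stdGaussianDensity t) := by
    simpa using integrable_quadratic_mul_stdGaussianDensity 0 1 0
  have hl : Tendsto (fun t => -stdGaussianDensity t) atTop (𝓝 0) :=
    (tendsto_mul_stdGaussianDensity_atTop 0 (-1)).congr fun t => by ring
  have h1 := integral_Ioi_of_hasDerivAt_of_tendsto' (a := x) (fun t _ => hd t) hi.integrableOn hl
  have h2 : x * gaussianQ x ≤ ∫ t in Ioi x, t * stdGaussianDensity t := by
    have : x * gaussianQ x = ∫ t in Ioi x, x * stdGaussianDensity t := by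
      rw [integral_const_mul]; rfl
    rw [this]
    refine setIntegral_mono_on (integrable_stdGaussianDensity.const_mul x).integrableOn
      hi.integrableOn measurableSet_Ioi fun t ht => ?_
    exact mul_le_mul_of_nonneg_right (le_of_lt ht) (stdGaussianDensity_pos t).le
  rw [gaussianHazard, le_div_iff₀ (gaussianQ_pos x)]
  linarith

/-- The hazard rate is `1`-Lipschitz: the variance of a truncated Gaussian is nonnegative. -/
lemma gaussianHazard_mul_sub_le_one (x : ℝ) :
    gaussianHazard x * (gaussianHazard x - x) ≤ 1 := by
  -- `gaussianHazard x` is the mean of the Gaussian truncated to `(x, ∞)`, so this integral is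
  -- `gaussianQ x` times the truncated variance.
  have h0 : 0 ≤ ∫ t in Ioi x, (t - gaussianHazard x) ^ 2 * stdGaussianDensity t :=
    integral_nonneg fun t => mul_nonneg (sq_nonneg _) (stdGaussianDensity_pos t).le
  rw [integral_Ioi_sub_sq_mul_stdGaussianDensity, ← gaussianHazard_mul_gaussianQ x] at h0
  have h1 : 0 ≤ gaussianQ x * (1 - gaussianHazard x * (gaussianHazard x - x)) := by
    convert h0 using 1; ring
  linarith [nonneg_of_mul_nonneg_right h1 (gaussianQ_pos x)]

lemma gaussianHazard_mul_sub_nonneg (x : ℝ) : 0 ≤ gaussianHazard x * (gaussianHazard x - x) :=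
  mul_nonneg (gaussianHazard_pos x).le (sub_nonneg.2 (le_gaussianHazard x))

lemma hasDerivAt_log_gaussianQ (x : ℝ) :
    HasDerivAt (fun x => Real.log (gaussianQ x)) (-gaussianHazard x) x := by
  convert (hasDerivAt_gaussianQ x).log (gaussianQ_pos x).ne' using 1
  rw [gaussianHazard, neg_div]

lemma continuous_log_gaussianQ : Continuous fun x => Real.log (gaussianQ x) :=
  continuous_gaussianQ.log fun x => (gaussianQ_pos x).ne'

/-- Mean value inequality on `[-|x|, |x|]`, where the derivative is at most its bound at the
endpoint. It supplies the growth estimates behind all later integrability claims. -/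
lemma abs_sub_le_of_hasDerivAt_of_linear_bound {f f' : ℝ → ℝ} (hf : ∀ x, HasDerivAt f (f' x) x)
    {A B : ℝ} (hB : 0 ≤ B) (hb : ∀ x, |f' x| ≤ A + B * |x|) (x : ℝ) :
    |f x - f 0| ≤ (A + B * |x|) * |x| := by
  have := Convex.norm_image_sub_le_of_norm_hasDerivWithin_le (f := f) (f' := f')
    (s := Icc (-|x|) |x|) (C := A + B * |x|) (x := 0) (y := x)
    (fun y _ => (hf y).hasDerivWithinAt) (fun y hy => (hb y).trans (by
      have := abs_le.2 hy; gcongr)) (convex_Icc _ _)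
    (by simp) (by simp [neg_abs_le, le_abs_self])
  simpa using this

lemma gaussianHazard_le (x : ℝ) : gaussianHazard x ≤ gaussianHazard 0 + |x| := by
  have := abs_sub_le_of_hasDerivAt_of_linear_bound hasDerivAt_gaussianHazard (A := 1) (B := 0)
    le_rfl (fun y => by
      rw [abs_of_nonneg (gaussianHazard_mul_sub_nonneg y)]
      simpa using gaussianHazard_mul_sub_le_one y) x
  have := le_abs_self (gaussianHazard x - gaussianHazard 0)
  linarith

lemma quadratic_bound_of_linear_bound_deriv {f f' : ℝ → ℝ} (hf : ∀ x, HasDerivAt f (f' x) x)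
    {A B : ℝ} (hA : 0 ≤ A) (hB : 0 ≤ B) (hb : ∀ x, |f' x| ≤ A + B * |x|) (x : ℝ) :
    |f x| ≤ (|f 0| + A) + (A + B) * x ^ 2 := by
  have h := abs_sub_le_of_hasDerivAt_of_linear_bound hf hB hb x
  have h2 : |f x| ≤ |f x - f 0| + |f 0| := by
    simpa using abs_add_le (f x - f 0) (f 0)
  have h1 : |x| ≤ 1 + x ^ 2 := by nlinarith [sq_nonneg (|x| - 1), sq_abs x, abs_nonneg x]
  have h3 : |x| * |x| = x ^ 2 := by rw [← sq, sq_abs]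
  nlinarith [mul_le_mul_of_nonneg_left h1 hA]

lemma abs_neg_gaussianHazard_le (x : ℝ) : |(-gaussianHazard x)| ≤ gaussianHazard 0 + 1 * |x| := by
  rw [abs_neg, abs_of_pos (gaussianHazard_pos x), one_mul]
  exact gaussianHazard_le x

lemma abs_log_gaussianQ_le (x : ℝ) : |Real.log (gaussianQ x)| ≤
    (|Real.log (gaussianQ 0)| + gaussianHazard 0) + (gaussianHazard 0 + 1) * x ^ 2 :=
  quadratic_bound_of_linear_bound_deriv hasDerivAt_log_gaussianQ (gaussianHazard_pos 0).le
    zero_le_one abs_neg_gaussianHazard_le x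


/-! ### Exponentially modified Gaussian density and its log-concavity. -/

/-- The density of the sum of independent `Exp(s)` and standard Gaussian variables. -/
noncomputable def expGaussDensity (s y : ℝ) : ℝ :=
  s * Real.exp (s ^ 2 / 2 - s * y) * gaussianQ (s - y)

lemma emgDensity_two_div_sq {s : ℝ} (hs : 0 < s) : emgDensity (2 / s ^ 2) = expGaussDensity s := by
  ext y
  have h : √(2 / (2 / s ^ 2)) = s := by
    rw [show (2 : ℝ) / (2 / s ^ 2) = s ^ 2 by field_simp, Real.sqrt_sq hs.le]
  simp only [emgDensity, expGaussDensity, h]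
  rw [show 1 / (2 / s ^ 2) - y * s = s ^ 2 / 2 - s * y by field_simp,
    show -y + s = s - y by ring]

lemma expGaussDensity_pos {s : ℝ} (hs : 0 < s) (y : ℝ) : 0 < expGaussDensity s y :=
  mul_pos (mul_pos hs (Real.exp_pos _)) (gaussianQ_pos _)

lemma contDiff_expGaussDensity (s : ℝ) : ContDiff ℝ 2 (expGaussDensity s) := by
  unfold expGaussDensity
  have := contDiff_gaussianQ.comp (contDiff_const.sub contDiff_id : ContDiff ℝ 2 fun y => s - y)
  exact ContDiff.mul (by fun_prop) this

lemma continuous_expGaussDensity (s : ℝ) : Continuous (expGaussDensity s) :=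
  (contDiff_expGaussDensity s).continuous

lemma log_expGaussDensity {s : ℝ} (hs : 0 < s) (y : ℝ) :
    Real.log (expGaussDensity s y) =
      Real.log s + (s ^ 2 / 2 - s * y) + Real.log (gaussianQ (s - y)) := by
  rw [expGaussDensity, Real.log_mul (by positivity) (gaussianQ_pos _).ne',
    Real.log_mul hs.ne' (Real.exp_pos _).ne', Real.log_exp]

lemma logDensitySecondDeriv_expGaussDensity {s : ℝ} (hs : 0 < s) (y : ℝ) :
    logDensitySecondDeriv (expGaussDensity s) y =
      -(gaussianHazard (s - y) * (gaussianHazard (s - y) - (s - y))) := by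
  have hsub (y : ℝ) : HasDerivAt (fun y : ℝ => s - y) (-1) y := (hasDerivAt_id y).const_sub s
  have h1 : deriv (fun u => Real.log (expGaussDensity s u)) = fun u => -s + gaussianHazard (s - u) := by
    ext u
    simp_rw [log_expGaussDensity hs]
    have h := ((((hasDerivAt_id u).const_mul s).const_sub (s ^ 2 / 2)).const_add (Real.log s)).fun_add
      ((hasDerivAt_log_gaussianQ (s - u)).comp u (hsub u))
    exact (h.congr_deriv (by ring)).deriv
  rw [logDensitySecondDeriv, iteratedDeriv_succ, iteratedDeriv_one, h1]
  exact ((((hasDerivAt_gaussianHazard (s - y)).comp y (hsub y)).const_add (-s)).congr_deriv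
    (by ring)).deriv

lemma logDensitySecondDeriv_expGaussDensity_mem_Icc {s : ℝ} (hs : 0 < s) (y : ℝ) :
    logDensitySecondDeriv (expGaussDensity s) y ∈ Icc (-1 : ℝ) 0 := by
  rw [logDensitySecondDeriv_expGaussDensity hs]
  exact ⟨neg_le_neg (gaussianHazard_mul_sub_le_one _),
    neg_nonpos.2 (gaussianHazard_mul_sub_nonneg _)⟩

lemma continuous_logDensitySecondDeriv_expGaussDensity {s : ℝ} (hs : 0 < s) :
    Continuous (logDensitySecondDeriv (expGaussDensity s)) := by
  rw [funext (logDensitySecondDeriv_expGaussDensity hs)]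
  have := continuous_gaussianHazard
  fun_prop

/-! ### The exponential law and its convolution with a Gaussian. -/

lemma integral_Ioi_stdGaussianDensity_add (a : ℝ) :
    ∫ t in Ioi 0, stdGaussianDensity (t + a) = gaussianQ a := by
  have h : (fun t : ℝ => t + a) ⁻¹' Ioi a = Ioi 0 := by ext; simp
  rw [← h, (measurePreserving_add_right volume a).setIntegral_preimage_emb
    (measurableEmbedding_addRight a)]
  rfl

lemma expMeasure_eq_withDensity (s : ℝ) :
    expMeasure s = volume.withDensity (exponentialPDF s) := rfl

lemma measurable_exponentialPDF (s : ℝ) : Measurable (exponentialPDF s) :=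
  (measurable_exponentialPDFReal s).ennreal_ofReal

/-- Completing the square in the convolution integrand pulls out `exp(s²/2 - s y)` and leaves a
Gaussian density at `t + (s - y)`; integrating over `t > 0` gives the tail at `s - y`. -/
lemma expMeasure_conv_stdGaussian {s : ℝ} (hs : 0 < s) :
    expMeasure s ∗ gaussianReal 0 1 =
      volume.withDensity (fun y => ENNReal.ofReal (expGaussDensity s y)) := by
  rw [expMeasure_eq_withDensity, gaussianReal_of_var_ne_zero _ (by simp),
    conv_withDensity_eq_lconvolution (measurable_exponentialPDF s) (measurable_gaussianPDF 0 1)]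
  congr 1
  ext y
  rw [lconvolution_def]
  have h1 (t : ℝ) : exponentialPDF s t * gaussianPDF 0 1 (-t + y) = (Ici 0).indicator
      (fun t => ENNReal.ofReal (s * Real.exp (s ^ 2 / 2 - s * y) *
        stdGaussianDensity (t + (s - y)))) t := by
    by_cases ht : 0 ≤ t
    · rw [indicator_of_mem (by exact ht), exponentialPDF_of_nonneg ht, gaussianPDF,
        ← stdGaussianDensity_eq_gaussianPDFReal, ← ENNReal.ofReal_mul (by positivity)]
      congr 1
      have : Real.exp (-(s * t)) * Real.exp (-(-t + y) ^ 2 / 2) =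
          Real.exp (s ^ 2 / 2 - s * y) * Real.exp (-(t + (s - y)) ^ 2 / 2) := by
        rw [← Real.exp_add, ← Real.exp_add]; ring_nf
      simp only [stdGaussianDensity]
      linear_combination (s * (1 / √(2 * Real.pi))) * this
    · rw [indicator_of_notMem (by exact ht), exponentialPDF_of_neg (not_le.1 ht), zero_mul]
  simp_rw [h1]
  rw [lintegral_indicator measurableSet_Ici, setLIntegral_congr Ioi_ae_eq_Ici.symm,
    ← ofReal_integral_eq_lintegral_ofReal]
  · rw [integral_const_mul, integral_Ioi_stdGaussianDensity_add, expGaussDensity]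
  · exact ((integrable_stdGaussianDensity.comp_add_right (s - y)).const_mul _).integrableOn
  · exact Eventually.of_forall fun t => mul_nonneg (by positivity) (stdGaussianDensity_pos _).le

lemma expMeasure_map_mul {r c : ℝ} (hr : 0 < r) (hc : 0 < c) :
    (expMeasure r).map (fun x => c * x) = expMeasure (r / c) := by
  have := isProbabilityMeasure_expMeasure hr
  have := isProbabilityMeasure_expMeasure (div_pos hr hc)
  have : IsProbabilityMeasure ((expMeasure r).map (fun x => c * x)) :=
    Measure.isProbabilityMeasure_map (by fun_prop)
  refine Measure.eq_of_cdf _ _ ?_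
  ext x
  have h : cdf ((expMeasure r).map (fun x => c * x)) x = cdf (expMeasure r) (x / c) := by
    rw [cdf_eq_real, cdf_eq_real, map_measureReal_apply (by fun_prop) measurableSet_Iic]
    congr 1
    ext t
    simp [le_div_iff₀ hc, mul_comm]
  rw [h, cdf_expMeasure_eq hr, cdf_expMeasure_eq (div_pos hr hc)]
  have : 0 ≤ x / c ↔ 0 ≤ x := by simp [le_div_iff₀ hc]
  simp only [this]
  congr 4
  ring

lemma integral_expMeasure_eq {r : ℝ} (hr : 0 < r) (F : ℝ → ℝ) :
    ∫ x, F x ∂expMeasure r = ∫ x in Ioi 0, r * Real.exp (-(r * x)) * F x := by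
  rw [expMeasure_eq_withDensity, integral_withDensity_eq_integral_toReal_smul
    (measurable_exponentialPDF r) (by simp [exponentialPDF]),
    ← integral_Ici_eq_integral_Ioi, ← integral_indicator measurableSet_Ici]
  congr with x
  by_cases hx : 0 ≤ x
  · rw [indicator_of_mem (by exact hx), exponentialPDF_of_nonneg hx,
      ENNReal.toReal_ofReal (by positivity), smul_eq_mul]
  · rw [indicator_of_notMem (by exact hx), exponentialPDF_of_neg (not_le.1 hx)]
    simp

lemma integral_pow_expMeasure {r : ℝ} (hr : 0 < r) (k : ℕ) :
    ∫ x, x ^ k ∂expMeasure r = k.factorial / r ^ k := by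
  have h := Real.integral_rpow_mul_exp_neg_mul_Ioi (a := k + 1) (by positivity) hr
  simp only [add_sub_cancel_right, Real.rpow_natCast] at h
  have h2 : ∀ x : ℝ, r * Real.exp (-(r * x)) * x ^ k = r * (x ^ k * Real.exp (-(r * x))) :=
    fun x => by ring
  rw [integral_expMeasure_eq hr]
  simp_rw [h2]
  rw [integral_const_mul, h, Real.Gamma_nat_eq_factorial,
    show (k : ℝ) + 1 = ((k + 1 : ℕ) : ℝ) by push_cast; ring, Real.rpow_natCast, one_div,
    inv_pow, pow_succ]
  field_simp

lemma integrable_pow_expMeasure {r : ℝ} (hr : 0 < r) (k : ℕ) :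
    Integrable (fun x => x ^ k) (expMeasure r) := by
  -- The integral of a non-integrable function is `0` by convention, so a nonzero value proves
  -- integrability.
  refine .of_integral_ne_zero ?_
  rw [integral_pow_expMeasure hr]
  positivity

lemma integrable_sq_expMeasure_conv_stdGaussian {s : ℝ} (hs : 0 < s) :
    Integrable (fun y => y ^ 2) (expMeasure s ∗ gaussianReal 0 1) := by
  have := isProbabilityMeasure_expMeasure hs
  have hT : MemLp (fun p : ℝ × ℝ => p.1) 2 ((expMeasure s).prod (gaussianReal 0 1)) := by
    rw [memLp_two_iff_integrable_sq (by fun_prop)]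
    exact (integrable_pow_expMeasure hs 2).comp_fst _
  have hW : MemLp (fun p : ℝ × ℝ => p.2) 2 ((expMeasure s).prod (gaussianReal 0 1)) := by
    rw [memLp_two_iff_integrable_sq (by fun_prop)]
    exact integrable_sq_stdGaussian.comp_snd _
  rw [Measure.conv, integrable_map_measure (by fun_prop) (by fun_prop)]
  exact (hT.add hW).integrable_sq

lemma isProbabilityMeasure_expMeasure_conv {s : ℝ} (hs : 0 < s) :
    IsProbabilityMeasure (expMeasure s ∗ gaussianReal 0 1) := by
  have := isProbabilityMeasure_expMeasure hs
  infer_instance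

/-! ### Reflected output density and the identity for the expected log-tail. -/

/-- The density of `s - Y`, where `Y` is exponentially modified Gaussian. -/
noncomputable def reflectedDensity (s x : ℝ) : ℝ :=
  s * Real.exp (s * x - s ^ 2 / 2) * gaussianQ x

lemma integral_expMeasure_conv_reflect {s : ℝ} (hs : 0 < s) (F : ℝ → ℝ) :
    ∫ y, F (s - y) ∂(expMeasure s ∗ gaussianReal 0 1) = ∫ x, reflectedDensity s x * F x := by
  rw [expMeasure_conv_stdGaussian hs, integral_withDensity_eq_integral_toReal_smul
    (continuous_expGaussDensity s).measurable.ennreal_ofReal (by simp),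
    ← integral_sub_left_eq_self (fun x => reflectedDensity s x * F x) volume s]
  congr with y
  rw [ENNReal.toReal_ofReal (expGaussDensity_pos hs y).le, smul_eq_mul, expGaussDensity,
    reflectedDensity]
  ring_nf

lemma integrable_reflectedDensity_mul_iff {s : ℝ} (hs : 0 < s) (F : ℝ → ℝ) :
    Integrable (fun x => reflectedDensity s x * F x) ↔
      Integrable (fun y => F (s - y)) (expMeasure s ∗ gaussianReal 0 1) := by
  rw [expMeasure_conv_stdGaussian hs, integrable_withDensity_iff_integrable_smul'
    (continuous_expGaussDensity s).measurable.ennreal_ofReal (by simp),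
    ← integrable_comp_sub_left (fun x => reflectedDensity s x * F x) s]
  refine integrable_congr (Eventually.of_forall fun y => ?_)
  simp only
  rw [ENNReal.toReal_ofReal (expGaussDensity_pos hs y).le, smul_eq_mul, expGaussDensity,
    reflectedDensity]
  ring_nf

lemma integrable_reflectedDensity_mul {s : ℝ} (hs : 0 < s) {F : ℝ → ℝ} (hF : Continuous F)
    {C D : ℝ} (hD : 0 ≤ D) (hb : ∀ x, |F x| ≤ C + D * x ^ 2) :
    Integrable (fun x => reflectedDensity s x * F x) := by
  have := isProbabilityMeasure_expMeasure_conv hs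
  rw [integrable_reflectedDensity_mul_iff hs]
  refine integrable_of_quadratic_bound (integrable_sq_expMeasure_conv_stdGaussian hs)
    (by fun_prop) (C := C + 2 * D * s ^ 2) (D := 2 * D) fun y => (hb _).trans ?_
  -- The constants come from `(s - y)² ≤ 2 s² + 2 y²`, whose slack is `(s + y)²`.
  nlinarith [mul_nonneg hD (sq_nonneg (s + y))]

lemma integral_reflectedDensity {s : ℝ} (hs : 0 < s) : ∫ x, reflectedDensity s x = 1 := by
  have := isProbabilityMeasure_expMeasure_conv hs
  simpa using (integral_expMeasure_conv_reflect hs (fun _ => 1)).symm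

/-- The hazard cancels the tail, and completing the square leaves a Gaussian centred at `s`. This is
the bridge between expectations over `s - Y` and over `s + W`. -/
lemma reflectedDensity_eq (s x : ℝ) :
    reflectedDensity s x * gaussianHazard x = s * stdGaussianDensity (x - s) := by
  rw [reflectedDensity, mul_assoc, mul_comm (gaussianQ x), gaussianHazard_mul_gaussianQ]
  have : Real.exp (s * x - s ^ 2 / 2) * Real.exp (-x ^ 2 / 2) = Real.exp (-(x - s) ^ 2 / 2) := by
    rw [← Real.exp_add]; ring_nf
  simp only [stdGaussianDensity]
  linear_combination (s * (1 / √(2 * Real.pi))) * this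

lemma hasDerivAt_reflectedDensity (s x : ℝ) : HasDerivAt (reflectedDensity s)
    (s * reflectedDensity s x - s * stdGaussianDensity (x - s)) x := by
  rw [← reflectedDensity_eq]
  have h1 : HasDerivAt (fun x : ℝ => s * x - s ^ 2 / 2) s x :=
    (((hasDerivAt_id x).const_mul s).sub_const _).congr_deriv (by simp)
  refine ((h1.exp.const_mul s).mul (hasDerivAt_gaussianQ x)).congr_deriv ?_
  rw [← gaussianHazard_mul_gaussianQ, reflectedDensity]
  ring

lemma integrable_stdGaussianDensity_sub_mul (s : ℝ) {F : ℝ → ℝ} (hF : Continuous F)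
    {C D : ℝ} (hD : 0 ≤ D) (hb : ∀ x, |F x| ≤ C + D * x ^ 2) :
    Integrable (fun x => stdGaussianDensity (x - s) * F x) := by
  have h : Integrable (fun w => stdGaussianDensity w * F (w + s)) := by
    rw [← integrable_stdGaussian_iff (fun w => F (w + s))]
    refine integrable_of_quadratic_bound integrable_sq_stdGaussian
      (by fun_prop) (C := C + 2 * D * s ^ 2) (D := 2 * D) fun y => (hb _).trans ?_
    nlinarith [mul_nonneg hD (sq_nonneg (s - y))]
  simpa using h.comp_sub_right s

lemma integral_stdGaussian_shift (s : ℝ) (F : ℝ → ℝ) :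
    ∫ w, F (s + w) ∂gaussianReal 0 1 = ∫ x, stdGaussianDensity (x - s) * F x := by
  rw [integral_stdGaussian_eq, ← integral_sub_right_eq_self _ s]
  simp

/-- The expected log-tail at `s - Y` in terms of a Gaussian expectation. -/
lemma integral_log_gaussianQ_conv {s : ℝ} (hs : 0 < s) :
    ∫ y, Real.log (gaussianQ (s - y)) ∂(expMeasure s ∗ gaussianReal 0 1) =
      1 + ∫ w, Real.log (gaussianQ (s + w)) ∂gaussianReal 0 1 := by
  rw [integral_expMeasure_conv_reflect hs (fun x => Real.log (gaussianQ x)),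
    integral_stdGaussian_shift s (fun x => Real.log (gaussianQ x))]
  have hD : 0 ≤ gaussianHazard 0 + 1 := by linarith [gaussianHazard_pos 0]
  have i1 := integrable_reflectedDensity_mul hs continuous_log_gaussianQ hD abs_log_gaussianQ_le
  have i2 := integrable_stdGaussianDensity_sub_mul s continuous_log_gaussianQ hD
    abs_log_gaussianQ_le
  have i3 : Integrable fun x => stdGaussianDensity (x - s) :=
    integrable_stdGaussianDensity.comp_sub_right s
  -- Integrating this total derivative over `ℝ` gives zero. By `reflectedDensity_eq` the term from
  -- `(log Q)' = -h` is again a shifted Gaussian, so `s` factors out and its unit mass is the `1` in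
  -- the identity.
  have hd (x : ℝ) : HasDerivAt (fun x => reflectedDensity s x * Real.log (gaussianQ x))
      (s * (reflectedDensity s x * Real.log (gaussianQ x) -
        stdGaussianDensity (x - s) * Real.log (gaussianQ x) - stdGaussianDensity (x - s))) x := by
    refine ((hasDerivAt_reflectedDensity s x).mul (hasDerivAt_log_gaussianQ x)).congr_deriv ?_
    linear_combination -reflectedDensity_eq s x
  have h0 := integral_eq_zero_of_hasDerivAt_of_integrable hd
    (((i1.sub i2).sub i3).const_mul s) i1
  rw [integral_const_mul, integral_sub (by exact i1.sub i2) i3, integral_sub i1 i2] at h0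
  have h1 : ∫ x, stdGaussianDensity (x - s) = 1 := by
    rw [integral_sub_right_eq_self, funext stdGaussianDensity_eq_gaussianPDFReal]
    exact integral_gaussianPDFReal_eq_one 0 (by simp)
  have := (mul_eq_zero.1 h0).resolve_left hs.ne'
  linarith


/-! ### Differentiating Gaussian expectations, and convexity in the noise variance. -/

lemma hasDerivAt_integral_stdGaussian_shift {f f' : ℝ → ℝ} (hf : ∀ x, HasDerivAt f (f' x) x)
    (hf' : Continuous f') {A B : ℝ} (hA : 0 ≤ A) (hB : 0 ≤ B) (hb : ∀ x, |f' x| ≤ A + B * |x|)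
    (s : ℝ) :
    HasDerivAt (fun s => ∫ w, f (s + w) ∂gaussianReal 0 1)
      (∫ w, f' (s + w) ∂gaussianReal 0 1) s := by
  have hfc : Continuous f := continuous_iff_continuousAt.2 fun x => (hf x).continuousAt
  have habs : Integrable (fun w : ℝ => |w|) (gaussianReal 0 1) :=
    ((memLp_id_gaussianReal (μ := 0) (v := 1) 1).integrable le_rfl).abs
  refine (hasDerivAt_integral_of_dominated_loc_of_deriv_le (Metric.ball_mem_nhds s one_pos)
    (F' := fun s w => f' (s + w)) (bound := fun w => A + B * (|s| + 1) + B * |w|)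
    (Eventually.of_forall fun t => by fun_prop) ?_ (by fun_prop)
    (Eventually.of_forall fun w t ht => ?_) ((integrable_const _).add (habs.const_mul B))
    (Eventually.of_forall fun w t _ => ?_)).2
  · refine integrable_of_quadratic_bound integrable_sq_stdGaussian (by fun_prop)
      (C := |f 0| + A + 2 * (A + B) * s ^ 2) (D := 2 * (A + B)) fun w =>
        (quadratic_bound_of_linear_bound_deriv hf hA hB hb _).trans ?_
    nlinarith [mul_nonneg (add_nonneg hA hB) (sq_nonneg (s - w))]
  -- Inside the unit ball around `s`, `|t| ≤ |s| + 1`; this gives the dominating function.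
  · rw [Metric.mem_ball, Real.dist_eq] at ht
    have h1 : |t + w| ≤ |s| + 1 + |w| := by
      calc |t + w| = |s + (t - s) + w| := by ring_nf
        _ ≤ |s| + |t - s| + |w| := abs_add_three _ _ _
        _ ≤ _ := by linarith
    calc ‖f' (t + w)‖ ≤ A + B * |t + w| := hb _
      _ ≤ A + B * (|s| + 1 + |w|) := by gcongr
      _ = _ := by ring
  · exact (hf (t + w)).comp_add_const t w

/-- The expected Gaussian hazard rate at a Gaussian point. -/
noncomputable def expectedHazard (s : ℝ) : ℝ :=
  ∫ w, gaussianHazard (s + w) ∂gaussianReal 0 1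

/-- The expectation of the derivative of the hazard rate. -/
noncomputable def expectedHazardDeriv (s : ℝ) : ℝ :=
  ∫ w, gaussianHazard (s + w) * (gaussianHazard (s + w) - (s + w)) ∂gaussianReal 0 1

lemma hasDerivAt_integral_log_gaussianQ (s : ℝ) :
    HasDerivAt (fun s => ∫ w, Real.log (gaussianQ (s + w)) ∂gaussianReal 0 1)
      (-expectedHazard s) s := by
  have := hasDerivAt_integral_stdGaussian_shift hasDerivAt_log_gaussianQ
    continuous_gaussianHazard.neg (gaussianHazard_pos 0).le zero_le_one abs_neg_gaussianHazard_le s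
  rwa [integral_neg] at this

lemma continuous_gaussianHazard_mul_sub :
    Continuous fun x => gaussianHazard x * (gaussianHazard x - x) := by
  have := continuous_gaussianHazard
  fun_prop

lemma hasDerivAt_expectedHazard (s : ℝ) :
    HasDerivAt expectedHazard (expectedHazardDeriv s) s :=
  hasDerivAt_integral_stdGaussian_shift hasDerivAt_gaussianHazard
    continuous_gaussianHazard_mul_sub (A := 1) (B := 0) zero_le_one le_rfl (fun x => by
      rw [abs_of_nonneg (gaussianHazard_mul_sub_nonneg x)]
      simpa using gaussianHazard_mul_sub_le_one x) s

/-- The second-order inequality behind convexity of the mutual information in the noise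
variance, which amounts to `E[((log f)'')²] ≤ 1` for the output density. -/
lemma mul_expectedHazard_sub_le {s : ℝ} (hs : 0 < s) :
    s * expectedHazard s - s ^ 2 * expectedHazardDeriv s ≤ 2 := by
  have hcH := continuous_gaussianHazard
  have hc := continuous_gaussianHazard_mul_sub
  set k : ℝ → ℝ := fun x => gaussianHazard x * (gaussianHazard x - x) with hk
  have hk0 (x : ℝ) : 0 ≤ k x := gaussianHazard_mul_sub_nonneg x
  have hk1 (x : ℝ) : k x ≤ 1 := gaussianHazard_mul_sub_le_one x
  have hab (x : ℝ) : |x| ≤ 1 + x ^ 2 := by nlinarith [sq_nonneg (|x| - 1), sq_abs x, abs_nonneg x]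
  have i1 : Integrable fun x => stdGaussianDensity (x - s) * gaussianHazard x :=
    integrable_stdGaussianDensity_sub_mul s hcH (C := gaussianHazard 0 + 1) zero_le_one
      fun x => by
        rw [abs_of_pos (gaussianHazard_pos x)]; linarith [gaussianHazard_le x, hab x]
  have i2 : Integrable fun x => stdGaussianDensity (x - s) * k x :=
    integrable_stdGaussianDensity_sub_mul s hc (C := 1) le_rfl fun x => by
      rw [abs_of_nonneg (hk0 x)]; linarith [hk1 x]
  have i3 : Integrable fun x => stdGaussianDensity (x - s) * (k x * (gaussianHazard x - x)) :=
    integrable_stdGaussianDensity_sub_mul s (by fun_prop) (C := gaussianHazard 0 + 2)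
      (D := 2) zero_le_two fun x => by
        have h0 : 0 ≤ gaussianHazard x - x := sub_nonneg.2 (le_gaussianHazard x)
        rw [abs_of_nonneg (mul_nonneg (hk0 x) h0)]
        have h1 := mul_le_mul_of_nonneg_right (hk1 x) h0
        linarith [gaussianHazard_le x, hab x, neg_abs_le x]
  -- Integrated over `ℝ`, this gives `2 E[k (h - x)] + s g' - g = 0`, all taken at `x = s + W`.
  have hd (x : ℝ) : HasDerivAt (fun x => stdGaussianDensity (x - s) * k x)
      (2 * (stdGaussianDensity (x - s) * (k x * (gaussianHazard x - x))) +
        s * (stdGaussianDensity (x - s) * k x) -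
        stdGaussianDensity (x - s) * gaussianHazard x) x := by
    have hkd := (hasDerivAt_gaussianHazard x).fun_mul
      ((hasDerivAt_gaussianHazard x).fun_sub (hasDerivAt_id x))
    refine (((hasDerivAt_stdGaussianDensity (x - s)).comp_sub_const x s).fun_mul hkd).congr_deriv ?_
    simp only [hk, id]
    ring
  have h0 := integral_eq_zero_of_hasDerivAt_of_integrable hd
    (((i3.const_mul 2).add (i2.const_mul s)).sub i1) i2
  rw [integral_sub (by exact (i3.const_mul 2).add (i2.const_mul s)) i1,
    integral_add (i3.const_mul 2) (i2.const_mul s), integral_const_mul, integral_const_mul] at h0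
  have hg : expectedHazard s = ∫ x, stdGaussianDensity (x - s) * gaussianHazard x :=
    integral_stdGaussian_shift s gaussianHazard
  have hg' : expectedHazardDeriv s = ∫ x, stdGaussianDensity (x - s) * k x :=
    integral_stdGaussian_shift s k
  have hR : Integrable (reflectedDensity s) := by
    simpa using integrable_reflectedDensity_mul hs (F := fun _ => 1) continuous_const (C := 1)
      le_rfl (by simp)
  -- By `reflectedDensity_eq` the integrand is `reflectedDensity s x * k x ^ 2`, so the integral is
  -- `E[((log f)''(Y))²]`, at most `1` since `0 ≤ k ≤ 1`.
  have hle : ∫ x, s * (stdGaussianDensity (x - s) * (k x * (gaussianHazard x - x))) ≤ 1 := by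
    rw [← integral_reflectedDensity hs]
    refine integral_mono (i3.const_mul s) hR fun x => ?_
    have hp : 0 ≤ reflectedDensity s x := by
      have := gaussianQ_pos x
      unfold reflectedDensity; positivity
    calc s * (stdGaussianDensity (x - s) * (k x * (gaussianHazard x - x)))
        = reflectedDensity s x * (k x * k x) := by
          simp only [hk]
          linear_combination -(gaussianHazard x * (gaussianHazard x - x) *
            (gaussianHazard x - x)) * reflectedDensity_eq s x
      _ ≤ reflectedDensity s x * 1 :=
          mul_le_mul_of_nonneg_left (mul_le_one₀ (hk1 x) (hk0 x) (hk1 x)) hp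
      _ = _ := mul_one _
  rw [integral_const_mul] at hle
  rw [← hg, ← hg'] at h0
  have : s * expectedHazard s - s ^ 2 * expectedHazardDeriv s =
      2 * (s * ∫ x, stdGaussianDensity (x - s) * (k x * (gaussianHazard x - x))) := by
    linear_combination -s * h0
  linarith

/-- Up to a constant, the mutual information over the exponential-input Gaussian channel as a
function of the noise variance relative to the squared input mean. -/
noncomputable def noiseInfo (v : ℝ) : ℝ :=
  -(Real.log v / 2) - v / 2 - ∫ w, Real.log (gaussianQ (√v + w)) ∂gaussianReal 0 1

lemma hasDerivAt_noiseInfo {v : ℝ} (hv : 0 < v) :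
    HasDerivAt noiseInfo (-(v⁻¹ / 2) - 1 / 2 + expectedHazard (√v) / (2 * √v)) v := by
  have h1 := ((Real.hasDerivAt_log hv.ne').div_const 2).fun_neg
  have h2 := (hasDerivAt_id v).div_const 2
  have h3 := (hasDerivAt_integral_log_gaussianQ (√v)).comp v (Real.hasDerivAt_sqrt hv.ne')
  exact ((h1.fun_sub h2).fun_sub h3).congr_deriv (by ring)

lemma convexOn_noiseInfo : ConvexOn ℝ (Ioi 0) noiseInfo := by
  refine convexOn_of_hasDerivWithinAt2_nonneg (convex_Ioi 0)
    (f' := fun v => -(v⁻¹ / 2) - 1 / 2 + expectedHazard (√v) / (2 * √v))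
    (f'' := fun v => (2 - (√v * expectedHazard (√v) - √v ^ 2 * expectedHazardDeriv (√v))) /
      (4 * v ^ 2))
    (fun v hv => (hasDerivAt_noiseInfo hv).continuousAt.continuousWithinAt) ?_ ?_ ?_
  · rw [interior_Ioi]
    exact fun v hv => (hasDerivAt_noiseInfo hv).hasDerivWithinAt
  · rw [interior_Ioi]
    intro v hv
    have hv : 0 < v := hv
    have hs : 0 < √v := Real.sqrt_pos.2 hv
    have hsd := Real.hasDerivAt_sqrt hv.ne'
    have h1 := ((hasDerivAt_inv hv.ne').div_const 2).fun_neg.sub_const (1 / 2)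
    have h2 := ((hasDerivAt_expectedHazard (√v)).comp v hsd).fun_div (hsd.const_mul 2)
      (by positivity)
    refine ((h1.fun_add h2).congr_deriv ?_).hasDerivWithinAt
    have hsq : √v ^ 2 = v := Real.sq_sqrt hv.le
    simp only [Function.comp]
    -- With the expectations abstracted and `v` replaced by `t²`, only a rational identity remains.
    generalize expectedHazard (√v) = a
    generalize expectedHazardDeriv (√v) = b
    generalize √v = t at *
    subst hsq
    field_simp
    ring
  · rw [interior_Ioi]
    intro v hv
    have := mul_expectedHazard_sub_le (Real.sqrt_pos.2 hv)
    exact div_nonneg (by linarith) (by positivity)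


/-! ### Mutual information of the normalized channel. -/

/-- The joint law of the input and the output of the exponential-input Gaussian channel has the
expected density with respect to the product of its marginals. -/
lemma joint_eq_withDensity {s : ℝ} (hs : 0 < s) :
    ((expMeasure s).prod (gaussianReal 0 1)).map (fun p : ℝ × ℝ => (p.1, p.1 + p.2)) =
      ((expMeasure s).prod (expMeasure s ∗ gaussianReal 0 1)).withDensity
        (fun p => ENNReal.ofReal (stdGaussianDensity (p.2 - p.1) / expGaussDensity s p.2)) := by
  have hd := (continuous_expGaussDensity s).measurable
  have hφ := continuous_stdGaussianDensity.measurable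
  have hk : Measurable fun p : ℝ × ℝ =>
      ENNReal.ofReal (stdGaussianDensity (p.2 - p.1) / expGaussDensity s p.2) := by fun_prop
  have := isProbabilityMeasure_expMeasure hs
  refine Measure.ext_of_lintegral _ fun F hF => ?_
  rw [lintegral_map hF (by fun_prop), lintegral_prod _ (by fun_prop),
    lintegral_withDensity_eq_lintegral_mul _ hk hF, lintegral_prod _ (by fun_prop)]
  refine lintegral_congr fun t => ?_
  rw [expMeasure_conv_stdGaussian hs, gaussianReal_of_var_ne_zero _ (by simp),
    lintegral_withDensity_eq_lintegral_mul _ (measurable_gaussianPDF 0 1) (by fun_prop),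
    lintegral_withDensity_eq_lintegral_mul _ (by fun_prop) (by fun_prop),
    -- For fixed input `t`, substitute `w = y - t`; the output density then cancels against the
    -- denominator.
    ← lintegral_sub_right_eq_self _ t]
  refine lintegral_congr fun y => ?_
  simp only [Pi.mul_apply, gaussianPDF, ← stdGaussianDensity_eq_gaussianPDFReal]
  rw [← mul_assoc, ← ENNReal.ofReal_mul (expGaussDensity_pos hs y).le,
    mul_div_cancel₀ _ (expGaussDensity_pos hs y).ne', add_sub_cancel]

lemma log_stdGaussianDensity (w : ℝ) :
    Real.log (stdGaussianDensity w) = -(Real.log (2 * Real.pi) / 2) - w ^ 2 / 2 := by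
  rw [stdGaussianDensity, Real.log_mul (by positivity) (Real.exp_pos _).ne', Real.log_exp, one_div,
    Real.log_inv, Real.log_sqrt (by positivity)]
  ring

lemma integral_sq_stdGaussian : ∫ w, w ^ 2 ∂gaussianReal 0 1 = 1 := by
  have h := variance_fun_id_gaussianReal (μ := 0) (v := 1)
  rw [variance_of_integral_eq_zero (by fun_prop) integral_id_gaussianReal] at h
  simpa using h

section Channel

variable {Ω : Type*} [MeasurableSpace Ω] {P : Measure Ω} [IsProbabilityMeasure P]
  {T W : Ω → ℝ} {s : ℝ}

omit [IsProbabilityMeasure P] in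
lemma hasLaw_add_expGauss (hs : 0 < s) (hT : HasLaw T (expMeasure s) P)
    (hW : HasLaw W (gaussianReal 0 1) P) (hTW : IndepFun T W P) :
    HasLaw (fun ω => T ω + W ω) (expMeasure s ∗ gaussianReal 0 1) P := by
  have := isProbabilityMeasure_expMeasure hs
  exact hTW.hasLaw_fun_add hT hW

/-- The log-ratio is affine in `T` and `W`, plus `-W²/2` and the log-tail at `s - Y`. The
contribution `s E[T] = 1` cancels the `1` from `integral_log_gaussianQ_conv`. -/
lemma integral_log_density_ratio (hs : 0 < s) (hT : HasLaw T (expMeasure s) P)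
    (hW : HasLaw W (gaussianReal 0 1) P) (hTW : IndepFun T W P) :
    Integrable (fun ω => Real.log (stdGaussianDensity (W ω) / expGaussDensity s (T ω + W ω))) P ∧
      ∫ ω, Real.log (stdGaussianDensity (W ω) / expGaussDensity s (T ω + W ω)) ∂P =
        noiseInfo (s ^ 2) - (Real.log (2 * Real.pi) + 1) / 2 := by
  have hpY := isProbabilityMeasure_expMeasure_conv hs
  have hY := hasLaw_add_expGauss hs hT hW hTW
  have iT : Integrable T P := by
    have := integrable_pow_expMeasure hs 1
    simp only [pow_one] at this
    rw [← hT.map_eq] at this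
    exact this.comp_aemeasurable hT.aemeasurable
  have iW : Integrable W P := by
    have := (memLp_id_gaussianReal (μ := 0) (v := 1) 1).integrable le_rfl
    rw [← hW.map_eq] at this
    exact this.comp_aemeasurable hW.aemeasurable
  have iW2 : Integrable (fun ω => W ω ^ 2) P := by
    have := integrable_sq_stdGaussian
    rw [← hW.map_eq] at this
    exact this.comp_aemeasurable hW.aemeasurable
  have hcQ := continuous_log_gaussianQ
  have iQ : Integrable (fun y => Real.log (gaussianQ (s - y)))
      (expMeasure s ∗ gaussianReal 0 1) :=
    (integrable_reflectedDensity_mul_iff hs fun x => Real.log (gaussianQ x)).1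
      (integrable_reflectedDensity_mul hs hcQ (by linarith [gaussianHazard_pos 0])
        abs_log_gaussianQ_le)
  have iQ' : Integrable (fun ω => Real.log (gaussianQ (s - (T ω + W ω)))) P := by
    rw [← hY.map_eq] at iQ
    exact iQ.comp_aemeasurable hY.aemeasurable
  have eT : ∫ ω, T ω ∂P = 1 / s := by
    rw [hT.integral_eq]
    simpa using integral_pow_expMeasure hs 1
  have eW : ∫ ω, W ω ∂P = 0 := by
    rw [hW.integral_eq, integral_id_gaussianReal]
  have eW2 : ∫ ω, W ω ^ 2 ∂P = 1 := by
    rw [← integral_sq_stdGaussian]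
    exact hW.integral_comp (f := fun w => w ^ 2) (by fun_prop)
  have eQ : ∫ ω, Real.log (gaussianQ (s - (T ω + W ω))) ∂P =
      1 + ∫ w, Real.log (gaussianQ (s + w)) ∂gaussianReal 0 1 := by
    rw [← integral_log_gaussianQ_conv hs]
    exact hY.integral_comp (f := fun y => Real.log (gaussianQ (s - y)))
      (hcQ.comp (continuous_sub_left s)).aestronglyMeasurable
  have hlog : (fun ω => Real.log (stdGaussianDensity (W ω) / expGaussDensity s (T ω + W ω))) =
      fun ω => (-(Real.log (2 * Real.pi) / 2) - Real.log s - s ^ 2 / 2) +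
        (s * T ω + s * W ω - W ω ^ 2 / 2 - Real.log (gaussianQ (s - (T ω + W ω)))) := by
    ext ω
    rw [Real.log_div (stdGaussianDensity_pos _).ne' (expGaussDensity_pos hs _).ne',
      log_stdGaussianDensity, log_expGaussDensity hs]
    ring
  have i1 := (iT.const_mul s).add (iW.const_mul s)
  have i2 := i1.sub (iW2.div_const 2)
  have i3 := i2.sub iQ'
  rw [hlog]
  refine ⟨(integrable_const _).add i3, ?_⟩
  rw [integral_add (integrable_const _) (by exact i3), integral_sub (by exact i2) iQ',
    integral_sub (by exact i1) (iW2.div_const 2),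
    integral_add (iT.const_mul s) (iW.const_mul s), integral_const_mul, integral_const_mul,
    integral_div, eT, eW, eW2, eQ, noiseInfo, Real.sqrt_sq hs.le, Real.log_pow]
  simp only [integral_const, probReal_univ, one_smul]
  field_simp
  push_cast
  ring

lemma mutualInfo_expGauss (hs : 0 < s) (hT : HasLaw T (expMeasure s) P)
    (hW : HasLaw W (gaussianReal 0 1) P) (hTW : IndepFun T W P) :
    mutualInfo P T (fun ω => T ω + W ω) ≠ ∞ ∧
      (mutualInfo P T (fun ω => T ω + W ω)).toReal =
        noiseInfo (s ^ 2) - (Real.log (2 * Real.pi) + 1) / 2 := by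
  have := isProbabilityMeasure_expMeasure hs
  have hY := hasLaw_add_expGauss hs hT hW hTW
  obtain ⟨hint, hval⟩ := integral_log_density_ratio hs hT hW hTW
  have hmT := hT.aemeasurable
  have hmY := hY.aemeasurable
  have hjoint : P.map (fun ω => (T ω, T ω + W ω)) = ((expMeasure s).prod
      (gaussianReal 0 1)).map (fun p : ℝ × ℝ => (p.1, p.1 + p.2)) := by
    rw [← (hTW.hasLaw_prod hT hW).map_eq, AEMeasurable.map_map_of_aemeasurable (by fun_prop)
      (hTW.hasLaw_prod hT hW).aemeasurable]
    rfl
  rw [joint_eq_withDensity hs] at hjoint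
  set ν := (expMeasure s).prod (expMeasure s ∗ gaussianReal 0 1) with hν
  set k : ℝ × ℝ → ℝ≥0∞ :=
    fun p => ENNReal.ofReal (stdGaussianDensity (p.2 - p.1) / expGaussDensity s p.2) with hk
  have hd := (continuous_expGaussDensity s).measurable
  have hφ := continuous_stdGaussianDensity.measurable
  have hkm : Measurable k := by fun_prop
  have hac : P.map (fun ω => (T ω, T ω + W ω)) ≪ ν :=
    hjoint ▸ withDensity_absolutelyContinuous ν k
  have hllr : llr (P.map (fun ω => (T ω, T ω + W ω))) ν
      =ᵐ[P.map (fun ω => (T ω, T ω + W ω))] fun p =>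
        Real.log (stdGaussianDensity (p.2 - p.1) / expGaussDensity s p.2) := by
    refine hac.ae_le ?_
    rw [hjoint]
    filter_upwards [Measure.rnDeriv_withDensity ν hkm] with p hp
    rw [llr, hp, ENNReal.toReal_ofReal]
    exact (div_pos (stdGaussianDensity_pos _) (expGaussDensity_pos hs _)).le
  have hmf : Measurable fun p : ℝ × ℝ =>
      Real.log (stdGaussianDensity (p.2 - p.1) / expGaussDensity s p.2) := by fun_prop
  have hi : Integrable (llr (P.map (fun ω => (T ω, T ω + W ω))) ν)
      (P.map (fun ω => (T ω, T ω + W ω))) := by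
    rw [integrable_congr hllr, integrable_map_measure hmf.aestronglyMeasurable (by fun_prop)]
    simpa [Function.comp_def] using hint
  have hMI : mutualInfo P T (fun ω => T ω + W ω) =
      InformationTheory.klDiv (P.map (fun ω => (T ω, T ω + W ω))) ν := by
    rw [mutualInfo, hT.map_eq, hY.map_eq]
  have : IsProbabilityMeasure (P.map (fun ω => (T ω, T ω + W ω))) :=
    Measure.isProbabilityMeasure_map (by fun_prop)
  rw [hMI]
  refine ⟨InformationTheory.klDiv_ne_top hac hi, ?_⟩
  -- Both measures have mass one, so the divergence is just the integral of the log-likelihood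
  -- ratio.
  rw [InformationTheory.toReal_klDiv_of_measure_eq hac (by simp), integral_congr_ae hllr,
    integral_map (by fun_prop) hmf.aestronglyMeasurable, ← hval]
  simp

/-- Mutual information is invariant under rescaling of the input and of the output. -/
lemma mutualInfo_const_mul {X Y : Ω → ℝ} (hX : AEMeasurable X P) (hY : AEMeasurable Y P)
    {c : ℝ} (hc : c ≠ 0) :
    mutualInfo P (fun ω => c * X ω) (fun ω => c * Y ω) = mutualInfo P X Y := by
  have key (c : ℝ) (X Y : Ω → ℝ) (hX : AEMeasurable X P) (hY : AEMeasurable Y P) :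
      mutualInfo P (fun ω => c * X ω) (fun ω => c * Y ω) ≤ mutualInfo P X Y := by
    have := Measure.isProbabilityMeasure_map hX
    have := Measure.isProbabilityMeasure_map hY
    have := Measure.isProbabilityMeasure_map (hX.prodMk hY)
    have hm : Measurable fun x : ℝ => c * x := by fun_prop
    have h := InformationTheory.klDiv_map_le (P.map fun ω => (X ω, Y ω))
      ((P.map X).prod (P.map Y)) (hm.prodMap hm)
    rwa [← Measure.map_prod_map _ _ hm hm, AEMeasurable.map_map_of_aemeasurable (by fun_prop) hX,
      AEMeasurable.map_map_of_aemeasurable (by fun_prop) hY,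
      AEMeasurable.map_map_of_aemeasurable (hm.prodMap hm).aemeasurable (hX.prodMk hY)] at h
  refine le_antisymm (key c X Y hX hY) ?_
  -- The data processing inequality for multiplication by `c⁻¹` gives the reverse bound.
  have := key c⁻¹ _ _ (hX.const_mul c) (hY.const_mul c)
  simpa only [inv_mul_cancel_left₀ hc] using this

end Channel


/-! ### Condition (C3), the feasible set and the normalization. -/

lemma conditionC3_expGauss {Ω : Type*} [MeasurableSpace Ω] {P : Measure Ω}
    [IsProbabilityMeasure P] {Y : Ω → ℝ} {s : ℝ} (hs : 0 < s)
    (hY : HasLaw Y (volume.withDensity fun y => ENNReal.ofReal (expGaussDensity s y)) P) :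
    ConditionC3 P Y (expGaussDensity s) := by
  have hb (ω : Ω) : logDensitySecondDeriv (expGaussDensity s) (Y ω) ^ 2 ≤ 1 := by
    have := logDensitySecondDeriv_expGaussDensity_mem_Icc hs (Y ω)
    rw [sq_le_one_iff_abs_le_one, abs_le]
    exact ⟨this.1, this.2.trans zero_le_one⟩
  have hm := (continuous_logDensitySecondDeriv_expGaussDensity hs).measurable
  have hmY := hY.aemeasurable
  have hi : Integrable (fun ω => logDensitySecondDeriv (expGaussDensity s) (Y ω) ^ 2) P :=
    (integrable_const (1 : ℝ)).mono'
      ((hm.comp_aemeasurable hmY).pow_const 2).aestronglyMeasurable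
      (Eventually.of_forall fun ω => by
        rw [Real.norm_of_nonneg (sq_nonneg _)]; exact hb ω)
  refine ⟨hY, expGaussDensity_pos hs, contDiff_expGaussDensity s, hi, ?_⟩
  simpa using integral_mono hi (integrable_const 1) hb

lemma convex_feasibleSet (m : ℕ) (N₀ : ℝ) : Convex ℝ (feasibleSet m N₀) := by
  intro x hx y hy a b ha hb hab
  refine ⟨?_, fun i => ?_⟩
  · simp only [Pi.add_apply, Pi.smul_apply, smul_eq_mul, Finset.sum_add_distrib, ← Finset.mul_sum]
    calc a * ∑ i, x i + b * ∑ i, y i ≤ a * N₀ + b * N₀ := by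
          gcongr
          exacts [hx.1, hy.1]
      _ = N₀ := by rw [← add_mul, hab, one_mul]
  · have := hx.2 i
    have := hy.2 i
    simp only [Pi.add_apply, Pi.smul_apply, smul_eq_mul]
    positivity

section Normalization

variable {Ω : Type*} [MeasurableSpace Ω] {P : Measure Ω} {X Z N : Ω → ℝ} {l z n : ℝ}

lemma power_expMeasure (hl : 0 < l) (hX : HasLaw X (expMeasure l) P) :
    power P X = 2 / l ^ 2 := by
  have h := hX.integral_comp (f := fun x => x ^ 2) (by fun_prop)
  rw [integral_pow_expMeasure hl] at h
  simpa [power] using h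

lemma snr_expMeasure (hl : 0 < l) (hX : HasLaw X (expMeasure l) P) :
    snr P X z n = 2 / (l ^ 2 * (n + z)) := by
  rw [snr, power_expMeasure hl hX, div_div]

lemma hasLaw_const_mul_expMeasure (hl : 0 < l) {c : ℝ} (hc : 0 < c)
    (hX : HasLaw X (expMeasure l) P) : HasLaw (fun ω => c * X ω) (expMeasure (l / c)) P :=
  HasLaw.fun_comp ⟨by fun_prop, expMeasure_map_mul hl hc⟩ hX

lemma hasLaw_normalizedInput (hl : 0 < l) (hX : HasLaw X (expMeasure l) P) :
    HasLaw (normalizedInput P X) (expMeasure (√2)) P := by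
  have hp : √(power P X) = √2 / l := by
    rw [power_expMeasure hl hX, Real.sqrt_div zero_le_two, Real.sqrt_sq hl.le]
  have h := hasLaw_const_mul_expMeasure hl (c := l / √2) (by positivity) hX
  have h2 : l / (l / √2) = √2 := by field_simp
  rw [h2] at h
  have h3 : normalizedInput P X = fun ω => l / √2 * X ω := by
    ext ω
    rw [normalizedInput, hp]
    field_simp
  rwa [h3]

/-- The artificial noise may be degenerate (`n = 0`); only the total variance `n + z` has to be
positive. -/
lemma hasLaw_normalizedNoise (hz : 0 < z) (hn : 0 ≤ n)
    (hZ : HasLaw Z (gaussianReal 0 z.toNNReal) P) (hN : HasLaw N (gaussianReal 0 n.toNNReal) P)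
    (hZN : IndepFun Z N P) : HasLaw (normalizedNoise Z N z n) (gaussianReal 0 1) P := by
  have h := hZN.hasLaw_fun_add hZ hN
  rw [gaussianReal_conv_gaussianReal] at h
  have hv : 0 < n + z := by positivity
  have hd := gaussianReal_div_const h (√(n + z))
  have hvar : (z.toNNReal + n.toNNReal) / NNReal.mk (√(n + z) ^ 2) (sq_nonneg _) = 1 := by
    ext
    simp [hz.le, hn, Real.sq_sqrt hv.le, add_comm z n, hv.ne']
  rwa [hvar, add_zero, zero_div] at hd

lemma normalizedOutput_eq (hl : 0 < l) (hz : 0 < z) (hn : 0 ≤ n)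
    (hX : HasLaw X (expMeasure l) P) (ω : Ω) :
    normalizedOutput P X Z N z n ω = (√(n + z))⁻¹ * X ω + normalizedNoise Z N z n ω := by
  have hp : 0 < power P X := by rw [power_expMeasure hl hX]; positivity
  have := Real.sqrt_pos.2 hp
  rw [normalizedOutput, snr, normalizedInput, Real.sqrt_div hp.le]
  field_simp

end Normalization

theorem mainTheorem7 {Ω : Type*} [MeasurableSpace Ω] (P : Measure Ω) [IsProbabilityMeasure P]
    (m : ℕ) (N₀ : ℝ) (l z : Fin m → ℝ) (hl : ∀ i, 0 < l i) (hz : ∀ i, 0 < z i)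
    (X Z : Fin m → Ω → ℝ) (N : (Fin m → ℝ) → Fin m → Ω → ℝ)
    (hX : ∀ i, HasLaw (X i) (expMeasure (l i)) P)
    (hZ : ∀ i, HasLaw (Z i) (gaussianReal 0 (z i).toNNReal) P)
    (hN : ∀ n ∈ feasibleSet m N₀, ∀ i, HasLaw (N n i) (gaussianReal 0 (n i).toNNReal) P)
    (hindep : ∀ n ∈ feasibleSet m N₀, ∀ i, iIndepFun ![X i, Z i, N n i] P) :
    -- the normalized channel, its exponentially modified Gaussian output, and (C3)
    (∀ n ∈ feasibleSet m N₀, ∀ i,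
      snr P (X i) (z i) (n i) = 2 / (l i ^ 2 * (n i + z i)) ∧
      HasLaw (normalizedInput P (X i)) (expMeasure (√2)) P ∧
      HasLaw (normalizedNoise (Z i) (N n i) (z i) (n i)) (gaussianReal 0 1) P ∧
      (∀ ω, normalizedOutput P (X i) (Z i) (N n i) (z i) (n i) ω =
        (X i ω + Z i ω + N n i ω) / √(n i + z i)) ∧
      HasLaw (normalizedOutput P (X i) (Z i) (N n i) (z i) (n i))
        (volume.withDensity
          (fun y => ENNReal.ofReal (emgDensity (snr P (X i) (z i) (n i)) y))) P ∧
      (∀ y, logDensitySecondDeriv (emgDensity (snr P (X i) (z i) (n i))) y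
        ∈ Set.Icc (-1 : ℝ) 0) ∧
      ConditionC3 P (normalizedOutput P (X i) (Z i) (N n i) (z i) (n i))
        (emgDensity (snr P (X i) (z i) (n i)))) ∧
    -- total mutual information minimization is a convex problem with finite objective
    (∀ n ∈ feasibleSet m N₀, ∀ i,
      mutualInfo P (X i) (fun ω => X i ω + Z i ω + N n i ω) ≠ ∞) ∧
    ConvexOn ℝ (feasibleSet m N₀)
      (fun n => ∑ i, (mutualInfo P (X i) (fun ω => X i ω + Z i ω + N n i ω)).toReal) := by
  have hv : ∀ n ∈ feasibleSet m N₀, ∀ i, 0 < n i + z i := fun n hn i =>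
    add_pos_of_nonneg_of_pos (hn.2 i) (hz i)
  have hs : ∀ n ∈ feasibleSet m N₀, ∀ i, 0 < l i * √(n i + z i) := fun n hn i =>
    mul_pos (hl i) (Real.sqrt_pos.2 (hv n hn i))
  have hρ : ∀ n ∈ feasibleSet m N₀, ∀ i,
      snr P (X i) (z i) (n i) = 2 / (l i * √(n i + z i)) ^ 2 := fun n hn i => by
    rw [snr_expMeasure (hl i) (hX i), mul_pow, Real.sq_sqrt (hv n hn i).le]
  have hmeas : ∀ n ∈ feasibleSet m N₀, ∀ i, ∀ j, AEMeasurable (![X i, Z i, N n i] j) P :=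
    fun n hn i j => by
      fin_cases j
      exacts [(hX i).aemeasurable, (hZ i).aemeasurable, (hN n hn i).aemeasurable]
  have hW : ∀ n ∈ feasibleSet m N₀, ∀ i,
      HasLaw (normalizedNoise (Z i) (N n i) (z i) (n i)) (gaussianReal 0 1) P := fun n hn i =>
    hasLaw_normalizedNoise (hz i) (hn.2 i) (hZ i) (hN n hn i)
      ((hindep n hn i).indepFun (i := 1) (j := 2) (by decide))
  have hT : ∀ n ∈ feasibleSet m N₀, ∀ i, HasLaw (fun ω => (√(n i + z i))⁻¹ * X i ω)
      (expMeasure (l i * √(n i + z i))) P := fun n hn i => by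
    have := hasLaw_const_mul_expMeasure (hl i) (inv_pos.2 (Real.sqrt_pos.2 (hv n hn i))) (hX i)
    rwa [div_inv_eq_mul] at this
  have hTW : ∀ n ∈ feasibleSet m N₀, ∀ i, IndepFun (fun ω => (√(n i + z i))⁻¹ * X i ω)
      (normalizedNoise (Z i) (N n i) (z i) (n i)) P := fun n hn i => by
    -- Joint independence of the triple makes the input independent of the total noise `Z + N`, not
    -- just of each noise separately.
    have h := (hindep n hn i).indepFun_add_right₀ (hmeas n hn i) 0 1 2 (by decide) (by decide)
    exact h.comp (φ := fun x => (√(n i + z i))⁻¹ * x) (ψ := fun x => x / √(n i + z i))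
      (by fun_prop) (by fun_prop)
  have hMI : ∀ n ∈ feasibleSet m N₀, ∀ i,
      mutualInfo P (X i) (fun ω => X i ω + Z i ω + N n i ω) ≠ ∞ ∧
      (mutualInfo P (X i) (fun ω => X i ω + Z i ω + N n i ω)).toReal =
        noiseInfo (l i ^ 2 * (n i + z i)) - (Real.log (2 * Real.pi) + 1) / 2 := fun n hn i => by
    have h := mutualInfo_expGauss (hs n hn i) (hT n hn i) (hW n hn i) (hTW n hn i)
    have he : (fun ω => (√(n i + z i))⁻¹ * X i ω + normalizedNoise (Z i) (N n i) (z i) (n i) ω) =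
        fun ω => (√(n i + z i))⁻¹ * (X i ω + Z i ω + N n i ω) := by
      ext ω
      simp only [normalizedNoise]
      ring
    have h1 := (hX i).aemeasurable
    have h2 := (hZ i).aemeasurable
    have h3 := (hN n hn i).aemeasurable
    rwa [he, mutualInfo_const_mul h1 (by fun_prop)
      (inv_pos.2 (Real.sqrt_pos.2 (hv n hn i))).ne', mul_pow, Real.sq_sqrt (hv n hn i).le] at h
  refine ⟨fun n hn i => ?_, fun n hn i => (hMI n hn i).1, ?_⟩
  · have hout : HasLaw (normalizedOutput P (X i) (Z i) (N n i) (z i) (n i)) (volume.withDensity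
        fun y => ENNReal.ofReal (expGaussDensity (l i * √(n i + z i)) y)) P := by
      rw [← expMeasure_conv_stdGaussian (hs n hn i),
        funext (normalizedOutput_eq (hl i) (hz i) (hn.2 i) (hX i))]
      exact hasLaw_add_expGauss (hs n hn i) (hT n hn i) (hW n hn i) (hTW n hn i)
    rw [hρ n hn i, emgDensity_two_div_sq (hs n hn i)]
    refine ⟨?_, hasLaw_normalizedInput (hl i) (hX i), hW n hn i, fun ω => ?_, hout,
      logDensitySecondDeriv_expGaussDensity_mem_Icc (hs n hn i),
      conditionC3_expGauss (hs n hn i) hout⟩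
    · rw [mul_pow, Real.sq_sqrt (hv n hn i).le]
    · rw [normalizedOutput_eq (hl i) (hz i) (hn.2 i) (hX i), normalizedNoise]
      ring
  · refine ⟨convex_feasibleSet m N₀, fun x hx y hy a b ha hb hab => ?_⟩
    have hxy := convex_feasibleSet m N₀ hx hy ha hb hab
    simp only [smul_eq_mul, Finset.mul_sum, ← Finset.sum_add_distrib]
    refine Finset.sum_le_sum fun i _ => ?_
    rw [(hMI _ hxy i).2, (hMI x hx i).2, (hMI y hy i).2]
    have hpos : ∀ n ∈ feasibleSet m N₀, l i ^ 2 * (n i + z i) ∈ Ioi (0 : ℝ) := fun n hn =>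
      mul_pos (pow_pos (hl i) 2) (hv n hn i)
    have h := convexOn_noiseInfo.2 (hpos x hx) (hpos y hy) ha hb hab
    -- The argument of `noiseInfo` is affine in the allocation, so `a + b = 1` carries convexity
    -- over; the same relation absorbs the additive constant at the end.
    have harg : a • (l i ^ 2 * (x i + z i)) + b • (l i ^ 2 * (y i + z i)) =
        l i ^ 2 * ((a • x + b • y) i + z i) := by
      simp only [Pi.add_apply, Pi.smul_apply, smul_eq_mul]
      linear_combination l i ^ 2 * z i * hab
    rw [harg, smul_eq_mul, smul_eq_mul] at h
    linear_combination h + (Real.log (2 * Real.pi) + 1) / 2 * hab
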